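/- **Setting.** For $v\in\mathbb R^n$ let $\Delta_c v=(v_2-v_1,\,v_3-v_2,\dots,v_1-v_n)$, let $H_v$ be the circulant matrix with first column $v$, i.e. $(H_v)_{ij}=v_{((i-j)\bmod n)+1}$, and let $P_p(v)$ and $P_n(v)$ be the numbers of positive and of negative entries of $v$. For a finite real sequence let $S^-$ be its number of sign changes after all zeros have been deleted, with $S^-=-1$ for the zero sequence. Put $$S_c^-(v)=\max_{1\le i\le n}S^-([v_i,\dots,v_n,v_1,\dots,v_i]),\qquad S_c^+(v)=\max_{w}S_c^-(w),$$ where $w$ runs over all vectors obtained from $v$ by replacing each zero entry by an arbitrary real number. (In the closed sequence $[v_i,\dots,v_n,v_1,\dots,v_i]$ both ends are the same entry $v_i$, so they receive the same replacement.) For a sequence $x:\mathbb Z\to\mathbb R$ write $x^P=(x(0),\dots,x(P-1))^\top$, and let $\ell_\infty(P)$ be the set of bounded $P$-periodic real sequences. A sequence $x$ is said to satisfy the *unimodality assumption* (with period $P$) if $x\in\ell_\infty(P)$, $S_c^-(\Delta_c x^P)=2$ and $S_c^+(x^P)=2$. The function $\operatorname{sign}$, with $\operatorname{sign}(0)=0$,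 acts entrywise. **Lemma.** Let $P>1$ be an integer. Let $g:\mathbb Z\to\mathbb R$ satisfy $\sum_t|g(t)|<\infty$, have support $\{t_1,t_1+1,t_1+2,\dots\}$ for some integer $t_1\ge 0$, and be strictly decreasing on its support. Let $u$ satisfy the unimodality assumption with period $P$. Let $o(t)=-\sum_{\tau\in\mathbb Z}g(t-\tau)\operatorname{sign}(u(\tau))$ be the loop gain and $\overline g(t)=\sum_{i\in\mathbb Z}g(t+iP)$ the periodic summation of $g$. Then the one-period vector of $o$ is $$o^P=-H_{\overline g^P}\operatorname{sign}(u^P),$$ and $$S_c^-(\Delta_c o^P)\le 2,\qquad S_c^-(o^P)\le 2.$$ If additionally $P_p(u^P)=P_n(u^P)$, then $S_c^+(o^P)\le 2$, and the sequence $o$ satisfies the unimodality assumption with period $P$; that is, $o\in\ell_\infty(P)$, $S_c^-(\Delta_c o^P)=2$ and $S_c^+(o^P)=2$. -/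

import Mathlib

namespace RelayFeedback

noncomputable section

/-! ### Sequences, one-period vectors, cyclic differences -/

/-- `x ∈ ℓ_∞(P)`: a bounded `P`-periodic real sequence on `ℤ`. -/
structure BoundedPeriodic (P : ℕ) (x : ℤ → ℝ) : Prop where
  bounded : BddAbove (Set.range fun t => |x t|)
  periodic : ∀ t, x (t + P) = x t

/-- The one-period vector `x^P = (x(0), …, x(P-1))`. -/
def truncate (P : ℕ) (x : ℤ → ℝ) : Fin P → ℝ := fun i => x ((i : ℕ) : ℤ)

/-- The cyclic forward difference `(v₂ - v₁, v₃ - v₂, …, v₁ - v_n)`. -/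
def cyclicDiff {n : ℕ} (v : Fin n → ℝ) : Fin n → ℝ := fun i => v (finRotate n i) - v i

/-- The number of positive entries of `v`. -/
def numPos {n : ℕ} (v : Fin n → ℝ) : ℕ := (Finset.univ.filter fun i => 0 < v i).card

/-- The number of negative entries of `v`. -/
def numNeg {n : ℕ} (v : Fin n → ℝ) : ℕ := (Finset.univ.filter fun i => v i < 0).card

/-! ### Variation -/

/-- `S^-`: the number of sign changes of a finite sequence after deletion of its zeros;
it is `-1` if nothing is left. -/
def signVar (l : List ℝ) : ℤ :=
  let w := l.filter fun x => decide (x ≠ 0)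
  if w = [] then -1 else (((w.zip w.tail).countP fun p => decide (p.1 * p.2 < 0) : ℕ) : ℤ)

/-- The closed rotation `[v_i, …, v_n, v_1, …, v_i]`, of length `n + 1`. -/
def closedRotation {n : ℕ} (v : Fin n → ℝ) (i : Fin n) : List ℝ :=
  (List.ofFn v).drop (i : ℕ) ++ (List.ofFn v).take ((i : ℕ) + 1)

/-- The cyclic variation `S_c^-(v) = sup_i S^-([v_i, …, v_n, v_1, …, v_i])`. -/
def cyclicVarMinus {n : ℕ} (v : Fin n → ℝ) : ℤ := ⨆ i : Fin n, signVar (closedRotation v i)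

/-- `w` arises from `v` by replacing the zero entries of `v` by arbitrary real numbers. -/
def IsZeroFilling {n : ℕ} (v w : Fin n → ℝ) : Prop := ∀ i, v i ≠ 0 → w i = v i

/-- The cyclic variation `S_c^+(v)`: the largest `S^-([w_i, …, w_n, w_1, …, w_i])` over all `i`
and all `w` that arise from `v` by replacing its zero entries. The two ends of the closed rotation
are the same entry of `v`, so that they receive the same value. -/
def cyclicVarPlus {n : ℕ} (v : Fin n → ℝ) : ℤ :=
  sSup {k : ℤ | ∃ w : Fin n → ℝ, IsZeroFilling v w ∧ k = cyclicVarMinus w}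

/-! The suprema above are taken over bounded sets. -/

theorem signVar_le_length (l : List ℝ) : signVar l ≤ l.length := by
  unfold signVar
  dsimp only
  split_ifs with h
  · have : (0 : ℤ) ≤ l.length := Int.natCast_nonneg _
    linarith
  · refine Int.ofNat_le.mpr (List.countP_le_length.trans ?_)
    rw [List.length_zip]
    exact (min_le_left _ _).trans (List.length_filter_le _ _)

theorem length_closedRotation {n : ℕ} (v : Fin n → ℝ) (i : Fin n) :
    (closedRotation v i).length = n + 1 := by
  have := i.isLt
  simp only [closedRotation, List.length_append, List.length_drop, List.length_take,
    List.length_ofFn]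
  omega

theorem bddAbove_range_signVar {n : ℕ} (v : Fin n → ℝ) :
    BddAbove (Set.range fun i : Fin n => signVar (closedRotation v i)) :=
  (Set.finite_range _).bddAbove

theorem cyclicVarMinus_le {n : ℕ} (v : Fin n → ℝ) : cyclicVarMinus v ≤ n + 1 := by
  unfold cyclicVarMinus
  rcases isEmpty_or_nonempty (Fin n) with h | h
  · rw [iSup, Set.range_eq_empty, Int.csSup_empty]
    positivity
  · refine ciSup_le fun i => (signVar_le_length _).trans ?_
    rw [length_closedRotation]
    push_cast
    exact le_rfl

theorem bddAbove_cyclicVarPlus {n : ℕ} (v : Fin n → ℝ) :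
    BddAbove {k : ℤ | ∃ w : Fin n → ℝ, IsZeroFilling v w ∧ k = cyclicVarMinus w} := by
  refine ⟨(n : ℤ) + 1, ?_⟩
  rintro k ⟨w, -, rfl⟩
  exact cyclicVarMinus_le w

/-! ### Convolution, periodic summation, and the loop gain -/

/-- The convolution operator `C_g(u)(t) = ∑_τ g(t - τ) u(τ)`. -/
def convolve (g u : ℤ → ℝ) (t : ℤ) : ℝ := ∑' τ : ℤ, g (t - τ) * u τ

/-- The periodic summation `ḡ(t) = ∑_i g(t + iP)`. -/
def periodicSum (P : ℕ) (g : ℤ → ℝ) (t : ℤ) : ℝ := ∑' i : ℤ, g (t + i * P)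

/-- The loop gain `o(t) = -C_g(sign(u))(t)`. -/
def loopGain (g u : ℤ → ℝ) (t : ℤ) : ℝ := -convolve g (fun τ => Real.sign (u τ)) t

/-- The impulse response is absolutely summable, its support is `{t₁, t₁ + 1, …}` for some integer
`t₁ ≥ 0`, and it is strictly decreasing on its support. -/
structure StrictlyDecreasingImpulse (g : ℤ → ℝ) : Prop where
  summable : Summable fun t => |g t|
  support_eq : ∃ t₁ : ℕ, Function.support g = Set.Ici (t₁ : ℤ)
  strictAntiOn : StrictAntiOn g (Function.support g)

/-- The unimodality assumption: `x ∈ ℓ_∞(P)`, `S_c^-(Δ_c x^P) = 2` and `S_c^+(x^P) = 2`. -/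
structure UnimodalityAssumption (P : ℕ) (x : ℤ → ℝ) : Prop where
  boundedPeriodic : BoundedPeriodic P x
  varMinus_diff : cyclicVarMinus (cyclicDiff (truncate P x)) = 2
  varPlus : cyclicVarPlus (truncate P x) = 2

end

end RelayFeedback

/-! Let `s = sign u` and let `d` be the forward difference of `o`. Since `g` and its shift have the
same sum, `o(t) - o(t-1) = -∑ (g(k-1) - g(k)) (c - s(t-k))` for every constant `c`. The weights are
positive for `k > t₁`, vanish for `k < t₁`, and only the one at `k = t₁` can be negative. With `t =
T + t₁` and `c = s(T)` that term drops out, so `d(T + t₁ - 1) < 0` wherever `u(T) > 0`, and `> 0`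
wherever `u(T) < 0` (`convolve_lt_of_isMax`).

Hence `d` has the signs of `-u`, shifted, except where `u` vanishes. `S_c^+ ≤ 2` means exactly that
`WeaklyAlternates` fails, a condition insensitive to those zeros, so it passes from `u` to `d`. A
cyclic Rolle argument (`WeaklyAlternates.diff`) passes it on to `o`. The lower bounds need only one
positive and one negative value: `d` always has both, and `o` has both when the balance of `sign u`
makes its sum over a period zero. -/

namespace RelayFeedback

/-! ### Sign changes and alternating subsequences -/

/-- The number of pairs of neighbouring entries of opposite sign. -/
noncomputable def signChanges (w : List ℝ) : ℕ := (w.zip w.tail).countP fun p => decide (p.1 * p.2 < 0)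

theorem signChanges_cons_cons (x y : ℝ) (r : List ℝ) :
    signChanges (x :: y :: r) = signChanges (y :: r) + if x * y < 0 then 1 else 0 := by
  simp [signChanges, List.countP_cons]

theorem signVar_of_filter_ne_nil {l : List ℝ}
    (h : (l.filter fun x => decide (x ≠ 0)) ≠ []) :
    signVar l = signChanges (l.filter fun x => decide (x ≠ 0)) := by
  unfold signVar signChanges
  exact if_neg h

theorem mul_neg_congr_of_mul_pos {x y z : ℝ} (h : 0 < x * y) : x * z < 0 ↔ y * z < 0 := by
  rcases pos_and_pos_or_neg_and_neg_of_mul_pos h with ⟨hx, hy⟩ | ⟨hx, hy⟩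
  · simp [mul_neg_iff, hx, hy, hx.not_gt, hy.not_gt]
  · simp [mul_neg_iff, hx, hy, hx.not_gt, hy.not_gt]

/-- Among nonzero numbers there is an alternating subsequence realizing all sign changes. -/
theorem exists_alternating_sublist (x : ℝ) (r : List ℝ) (h : ∀ y ∈ x :: r, y ≠ 0) :
    ∃ q : List ℝ, List.Sublist q r ∧ (x :: q).IsChain (fun a b => a * b < 0) ∧
      q.length = signChanges (x :: r) := by
  induction r generalizing x with
  | nil => exact ⟨[], by simp, by simp, by simp [signChanges]⟩
  | cons y r ih =>
    obtain ⟨q, hq, hc, hl⟩ := ih y fun z hz => h z (List.mem_cons_of_mem _ hz)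
    rw [signChanges_cons_cons]
    by_cases hxy : x * y < 0
    · exact ⟨y :: q, hq.cons_cons y, List.isChain_cons_cons.2 ⟨hxy, hc⟩, by simp [hxy, hl]⟩
    -- Equal signs: `x` can replace `y` as head of the alternating chain.
    · have hpos : 0 < x * y :=
        lt_of_le_of_ne (not_lt.1 hxy) (mul_ne_zero (h x (by simp)) (h y (by simp))).symm
      refine ⟨q, hq.cons y, ?_, by simp [hxy, hl]⟩
      cases q with
      | nil => simp
      | cons z q =>
        rw [List.isChain_cons_cons] at hc ⊢
        exact ⟨(mul_neg_congr_of_mul_pos hpos).2 hc.1, hc.2⟩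

/-- An alternating subsequence of a list of nonzero numbers has at most one more entry than the
list has sign changes, and no more if it starts with the sign opposite to that of the list. -/
theorem length_alternating_sublist_le (x : ℝ) (r : List ℝ) (h : ∀ y ∈ x :: r, y ≠ 0)
    (q : List ℝ) (hq : List.Sublist q (x :: r)) (hc : q.IsChain (fun a b => a * b < 0)) :
    q.length ≤ signChanges (x :: r) + 1 ∧
      ((x :: q).IsChain (fun a b => a * b < 0) → q.length ≤ signChanges (x :: r)) := by
  induction r generalizing x q with
  | nil =>
    rcases List.sublist_cons_iff.1 hq with hq | ⟨q', rfl, hq'⟩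
    · simp [List.sublist_nil.1 hq]
    · have : ¬ x * x < 0 := not_lt.2 (mul_self_nonneg x)
      simp [List.sublist_nil.1 hq', this]
  | cons y r ih =>
    have h' : ∀ z ∈ y :: r, z ≠ 0 := fun z hz => h z (List.mem_cons_of_mem _ hz)
    have hpos : ¬ x * y < 0 → 0 < x * y := fun hxy =>
      lt_of_le_of_ne (not_lt.1 hxy) (mul_ne_zero (h x (by simp)) (h y (by simp))).symm
    have key : ∀ p : List ℝ, List.Sublist p (y :: r) → (x :: p).IsChain (fun a b => a * b < 0) →
        p.length ≤ signChanges (x :: y :: r) := by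
      intro p hp hcp
      have hcp' := hcp.tail
      obtain ⟨h1, h2⟩ := ih y h' p hp hcp'
      rw [signChanges_cons_cons]
      by_cases hxy : x * y < 0
      · simpa [hxy] using h1
      · simp only [hxy, if_false, add_zero]
        apply h2
        cases p with
        | nil => simp
        | cons z p =>
          rw [List.isChain_cons_cons] at hcp ⊢
          exact ⟨(mul_neg_congr_of_mul_pos (hpos hxy)).1 hcp.1, hcp.2⟩
    rcases List.sublist_cons_iff.1 hq with hq | ⟨q', rfl, hq'⟩
    · refine ⟨?_, key q hq⟩
      have := (ih y h' q hq hc).1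
      rw [signChanges_cons_cons]
      omega
    · refine ⟨by simpa using key q' hq' hc, fun hcc => ?_⟩
      exact absurd (List.isChain_cons_cons.1 hcc).1 (not_lt.2 (mul_self_nonneg x))

/-- With `le_signVar_of_alternating_sublist` this describes `S^-` by alternating subsequences, so
that deleted zeros need not be tracked any more. -/
theorem exists_alternating_sublist_of_le_signVar {l : List ℝ} {k : ℕ} (hk : (k : ℤ) ≤ signVar l) :
    ∃ q : List ℝ, List.Sublist q l ∧ q.IsChain (fun a b => a * b < 0) ∧ q.length = k + 1 := by
  rcases hw : l.filter fun x => decide (x ≠ 0) with _ | ⟨x, r⟩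
  · unfold signVar at hk
    simp only [hw, if_true] at hk
    omega
  · rw [signVar_of_filter_ne_nil (by rw [hw]; exact List.cons_ne_nil _ _), hw, Nat.cast_le] at hk
    have hne : ∀ y ∈ x :: r, y ≠ 0 := fun y hy => by
      rw [← hw, List.mem_filter] at hy
      simpa using hy.2
    obtain ⟨q, hq, hc, hl⟩ := exists_alternating_sublist x r hne
    refine ⟨(x :: q).take (k + 1), (List.take_sublist _ _).trans ((hq.cons_cons x).trans ?_),
      hc.take _, by simp [hl, hk]⟩
    rw [← hw]
    exact List.filter_sublist

theorem le_signVar_of_alternating_sublist {l q : List ℝ} {k : ℕ} (hq : List.Sublist q l)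
    (hc : q.IsChain (fun a b => a * b < 0)) (h0 : ∀ y ∈ q, y ≠ 0) (hl : q.length = k + 1) :
    (k : ℤ) ≤ signVar l := by
  have hq' := hq.filter fun x => decide (x ≠ 0)
  rw [List.filter_eq_self.2 (by simpa using h0)] at hq'
  rcases hw : l.filter fun x => decide (x ≠ 0) with _ | ⟨x, r⟩
  · rw [hw, List.sublist_nil] at hq'
    simp [hq'] at hl
  · rw [signVar_of_filter_ne_nil (by rw [hw]; exact List.cons_ne_nil _ _), hw, Nat.cast_le]
    have hne : ∀ y ∈ x :: r, y ≠ 0 := fun y hy => by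
      rw [← hw, List.mem_filter] at hy
      simpa using hy.2
    rw [hw] at hq'
    have := (length_alternating_sublist_le x r hne q hq' hc).1
    omega

/-! ### Periodic sequences and their closed rotations -/

/-- Turns wrap-around into a window of `P + 1` consecutive integers. -/
theorem closedRotation_truncate {P : ℕ} {x : ℤ → ℝ}
    (hx : Function.Periodic x (P : ℤ)) (i : Fin P) :
    closedRotation (truncate P x) i =
      (List.range (P + 1)).map fun k => x (((i : ℕ) : ℤ) + (k : ℕ)) := by
  apply List.ext_getElem
  · rw [length_closedRotation]
    simp
  · intro k hk hk'
    simp only [List.length_map, List.length_range] at hk'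
    simp only [closedRotation, List.getElem_map, List.getElem_range, List.getElem_append,
      List.length_drop, List.length_ofFn, List.getElem_drop, List.getElem_ofFn, List.getElem_take,
      truncate]
    split_ifs with hlt
    · congr 1
    · rw [← hx]
      congr 1
      omega

theorem exists_closedRotation_eq {P : ℕ} (hP : 0 < P) {x : ℤ → ℝ}
    (hx : Function.Periodic x (P : ℤ)) (a : ℤ) :
    ∃ i : Fin P, closedRotation (truncate P x) i =
      (List.range (P + 1)).map fun k => x (a + (k : ℕ)) := by
  have hP' : (0 : ℤ) < P := by exact_mod_cast hP
  have hmod : ∀ k : ℤ, x (a % P + k) = x (a + k) := fun k => by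
    rw [← hx.int_mul (a / P) (a % P + k)]
    congr 1
    have := Int.emod_add_mul_ediv a P
    simp only [Int.cast_id]
    linarith
  have h1 := Int.emod_lt_of_pos a hP'
  lift a % P to ℕ using Int.emod_nonneg a hP'.ne' with m
  refine ⟨⟨m, by omega⟩, ?_⟩
  simp only [closedRotation_truncate hx, hmod]


/-! ### Weak alternation and cyclic variation -/

/-- A sequence that is `≥ 0`, `≤ 0`, `≥ 0`, `≤ 0` at four successive places of one period. -/
def WeaklyAlternates (P : ℕ) (x : ℤ → ℝ) : Prop :=
  ∃ a b c d : ℤ, a < b ∧ b < c ∧ c < d ∧ d < a + P ∧ 0 ≤ x a ∧ x b ≤ 0 ∧ 0 ≤ x c ∧ x d ≤ 0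

theorem sublist_map_range_of_pairwise_lt {α : Type*} (f : ℕ → α) {m : ℕ} {l : List ℕ}
    (hl : l.Pairwise (· < ·)) (hm : ∀ k ∈ l, k < m) :
    List.Sublist (l.map f) ((List.range m).map f) := by
  refine List.Sublist.map f (List.sublist_of_subperm_of_pairwise (r := (· < ·)) ?_ hl
    List.pairwise_lt_range)
  exact List.subperm_of_subset (hl.imp ne_of_lt) fun k hk => List.mem_range.2 (hm k hk)

theorem cyclicVarMinus_le_cyclicVarPlus {n : ℕ} (v : Fin n → ℝ) :
    cyclicVarMinus v ≤ cyclicVarPlus v :=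
  le_csSup (bddAbove_cyclicVarPlus v) ⟨v, fun _ _ => rfl, rfl⟩

theorem signVar_closedRotation_le_cyclicVarMinus {n : ℕ} (v : Fin n → ℝ) (i : Fin n) :
    signVar (closedRotation v i) ≤ cyclicVarMinus v :=
  le_ciSup (bddAbove_range_signVar v) i

/-- The periodic extension of a vector. -/
def periodicExtension {P : ℕ} (hP : 0 < P) (w : Fin P → ℝ) (t : ℤ) : ℝ :=
  w ⟨(t % P).toNat, by
    have := Int.emod_lt_of_pos t (by exact_mod_cast hP : (0 : ℤ) < P)
    omega⟩

theorem periodic_periodicExtension {P : ℕ} (hP : 0 < P) (w : Fin P → ℝ) :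
    Function.Periodic (periodicExtension hP w) (P : ℤ) := fun t => by
  simp [periodicExtension]

theorem truncate_periodicExtension {P : ℕ} (hP : 0 < P) (w : Fin P → ℝ) :
    truncate P (periodicExtension hP w) = w := by
  funext i
  unfold truncate periodicExtension
  congr 1
  ext
  have : ((i : ℕ) : ℤ) % P = (i : ℕ) := Int.emod_eq_of_lt (by positivity) (by exact_mod_cast i.2)
  simp [this]

theorem periodicExtension_truncate {P : ℕ} (hP : 0 < P) {x : ℤ → ℝ}
    (hx : Function.Periodic x (P : ℤ)) : periodicExtension hP (truncate P x) = x := by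
  have hP' : (0 : ℤ) < P := by exact_mod_cast hP
  funext t
  unfold truncate periodicExtension
  simp only [Int.toNat_of_nonneg (Int.emod_nonneg t hP'.ne')]
  rw [← hx.int_mul (t / P) (t % P)]
  congr 1
  have := Int.emod_add_mul_ediv t P
  simp only [Int.cast_id]
  linarith

theorem isZeroFilling_periodicExtension {P : ℕ} (hP : 0 < P) {x : ℤ → ℝ}
    (hx : Function.Periodic x (P : ℤ)) {w : Fin P → ℝ} (hw : IsZeroFilling (truncate P x) w)
    (t : ℤ) (ht : x t ≠ 0) : periodicExtension hP w t = x t := by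
  rw [← periodicExtension_truncate hP hx] at ht ⊢
  exact hw _ ht

/-- Three changes give the first and last of four entries opposite signs, so these cannot be the two
coinciding ends of the closed rotation. If the first is negative, it is moved to the end by one
period. -/
theorem exists_alternating_of_three_le_signVar {P : ℕ} {x : ℤ → ℝ}
    (hx : Function.Periodic x (P : ℤ)) {i : Fin P}
    (h : 3 ≤ signVar (closedRotation (truncate P x) i)) :
    ∃ a b c d : ℤ, a < b ∧ b < c ∧ c < d ∧ d < a + P ∧ 0 < x a ∧ x b < 0 ∧ 0 < x c ∧ x d < 0 := by
  obtain ⟨q, hq, hc, hl⟩ := exists_alternating_sublist_of_le_signVar (k := 3) h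
  rw [closedRotation_truncate hx, List.sublist_map_iff] at hq
  obtain ⟨l, hlr, rfl⟩ := hq
  rw [List.length_map] at hl
  obtain ⟨a, b, c, d, rfl⟩ := List.length_eq_four.1 hl
  have hpw := List.pairwise_lt_range.sublist hlr
  have hd : d < P + 1 := List.mem_range.1 (hlr.subset (by simp))
  simp only [List.pairwise_cons, List.mem_cons, List.not_mem_nil, or_false, forall_eq_or_imp,
    forall_eq] at hpw
  simp only [List.map_cons, List.map_nil, List.isChain_cons_cons] at hc
  obtain ⟨hab, hbc, hcd, -⟩ := hc
  obtain ⟨⟨h1, -⟩, ⟨h2, -⟩, h3, -⟩ := hpw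
  have hlast : d = a + P → x ((i : ℕ) + (d : ℕ)) = x ((i : ℕ) + (a : ℕ)) := fun hda => by
    rw [← hx ((i : ℕ) + (a : ℕ))]
    congr 1
    omega
  rcases mul_neg_iff.1 hab with ⟨ha, hb⟩ | ⟨ha, hb⟩
  · have hc := pos_of_mul_neg_right hbc hb.le
    have hd' := neg_of_mul_neg_right hcd hc.le
    have : d ≠ a + P := fun hda => by linarith [hlast hda]
    exact ⟨i + a, i + b, i + c, i + d, by omega, by omega, by omega, by omega, ha, hb, hc, hd'⟩
  · have hc := neg_of_mul_neg_right hbc hb.le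
    have hd' := pos_of_mul_neg_right hcd hc.le
    have : d ≠ a + P := fun hda => by linarith [hlast hda]
    refine ⟨i + b, i + c, i + d, i + a + P, by omega, by omega, by omega, by omega, hb, hc, hd', ?_⟩
    rwa [hx]

/-- A filling alters only zeros, so strict signs of the filling are weak signs of `x`. -/
theorem cyclicVarPlus_le_two {P : ℕ} (hP : 0 < P) {x : ℤ → ℝ}
    (hx : Function.Periodic x (P : ℤ)) (h : ¬ WeaklyAlternates P x) :
    cyclicVarPlus (truncate P x) ≤ 2 := by
  have : Nonempty (Fin P) := ⟨⟨0, hP⟩⟩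
  refine csSup_le ⟨_, _, fun _ _ => rfl, rfl⟩ ?_
  rintro k ⟨w, hw, rfl⟩
  refine ciSup_le fun i => ?_
  by_contra! hlt
  rw [← truncate_periodicExtension hP w] at hlt
  obtain ⟨a, b, c, d, hab, hbc, hcd, hda, ha, hb, hc, hd⟩ :=
    exists_alternating_of_three_le_signVar (periodic_periodicExtension hP w) (i := i) hlt
  have hf := isZeroFilling_periodicExtension hP hx hw
  have hpos : ∀ t, 0 < periodicExtension hP w t → 0 ≤ x t := fun t ht => by
    by_contra! hlt
    linarith [hf t hlt.ne]
  have hneg : ∀ t, periodicExtension hP w t < 0 → x t ≤ 0 := fun t ht => by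
    by_contra! hlt
    linarith [hf t hlt.ne']
  exact h ⟨a, b, c, d, hab, hbc, hcd, hda, hpos a ha, hneg b hb, hpos c hc, hneg d hd⟩

theorem not_weaklyAlternates_of_cyclicVarPlus_le_two {P : ℕ} (hP : 0 < P) {x : ℤ → ℝ}
    (hx : Function.Periodic x (P : ℤ)) (h : cyclicVarPlus (truncate P x) ≤ 2) :
    ¬ WeaklyAlternates P x := by
  rintro ⟨a, b, c, d, hab, hbc, hcd, hda, ha, hb, hc, hd⟩
  -- zeros congruent to `a` or `c` are replaced by `1`, all others by `-1`
  let y : ℤ → ℝ := fun t =>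
    if x t = 0 then (if (P : ℤ) ∣ t - a ∨ (P : ℤ) ∣ t - c then 1 else -1) else x t
  have hy : Function.Periodic y (P : ℤ) := fun t => by
    have h1 : ∀ s : ℤ, (P : ℤ) ∣ t + P - s ↔ (P : ℤ) ∣ t - s := fun s => by
      rw [show t + P - s = t - s + P by ring, dvd_add_self_right]
    simp only [y, hx t, h1]
  have hfill : IsZeroFilling (truncate P x) (truncate P y) := fun i hi => if_neg hi
  -- The four places lie within less than one period, hence are pairwise incongruent and the filling
  -- serves all of them at once.
  have hndvd : ∀ s t : ℤ, s < t → t < s + P → ¬ (P : ℤ) ∣ t - s := fun s t h1 h2 hdvd => by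
    have := Int.le_of_dvd (by omega) hdvd
    omega
  have hya : 0 < y a := by
    by_cases h0 : x a = 0
    · simp [y, h0]
    · simpa [y, h0] using lt_of_le_of_ne ha (Ne.symm h0)
  have hyc : 0 < y c := by
    by_cases h0 : x c = 0
    · simp [y, h0]
    · simpa [y, h0] using lt_of_le_of_ne hc (Ne.symm h0)
  have hyb : y b < 0 := by
    by_cases h0 : x b = 0
    · have h1 := hndvd a b hab (by omega)
      have h2 := hndvd b c hbc (by omega)
      rw [dvd_sub_comm] at h2
      simp [y, h0, h1, h2]
    · simpa [y, h0] using lt_of_le_of_ne hb h0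
  have hyd : y d < 0 := by
    by_cases h0 : x d = 0
    · have h1 := hndvd a d (by omega) (by omega)
      have h2 := hndvd c d hcd (by omega)
      simp [y, h0, h1, h2]
    · simpa [y, h0] using lt_of_le_of_ne hd h0
  obtain ⟨i, hi⟩ := exists_closedRotation_eq hP hy a
  have key : ((3 : ℕ) : ℤ) ≤ signVar (closedRotation (truncate P y) i) := by
    rw [hi]
    refine le_signVar_of_alternating_sublist (sublist_map_range_of_pairwise_lt _
      (l := [0, (b - a).toNat, (c - a).toNat, (d - a).toNat]) ?_ ?_) ?_ ?_ rfl
    · simp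
      omega
    · simp
      omega
    all_goals
      simp only [List.map_cons, List.map_nil, Int.toNat_of_nonneg (by omega : 0 ≤ b - a),
        Int.toNat_of_nonneg (by omega : 0 ≤ c - a), Int.toNat_of_nonneg (by omega : 0 ≤ d - a),
        add_sub_cancel, Nat.cast_zero, add_zero]
    · simp [mul_neg_of_pos_of_neg, mul_neg_of_neg_of_pos, *]
    · simp [hya.ne', hyb.ne, hyc.ne', hyd.ne]
  have h2 : cyclicVarMinus (truncate P y) ≤ cyclicVarPlus (truncate P x) :=
    le_csSup (bddAbove_cyclicVarPlus _) ⟨_, hfill, rfl⟩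
  have h3 := signVar_closedRotation_le_cyclicVarMinus (truncate P y) i
  push_cast at key
  linarith

/-- The rotation starting at the positive entry passes the negative one and closes at the positive
one again. -/
theorem two_le_cyclicVarMinus {P : ℕ} (hP : 0 < P) {x : ℤ → ℝ}
    (hx : Function.Periodic x (P : ℤ)) {a b : ℤ} (ha : 0 < x a) (hb : x b < 0) :
    2 ≤ cyclicVarMinus (truncate P x) := by
  have hP' : (0 : ℤ) < P := by exact_mod_cast hP
  have h0 := Int.emod_nonneg (b - a) hP'.ne'
  have h1 := Int.emod_lt_of_pos (b - a) hP'
  have hm : x (a + (b - a) % P) = x b := by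
    rw [← hx.int_mul ((b - a) / P)]
    congr 1
    have := Int.emod_add_mul_ediv (b - a) P
    simp only [Int.cast_id]
    linarith
  lift (b - a) % P to ℕ using h0 with m
  have hm0 : m ≠ 0 := by
    rintro rfl
    rw [Nat.cast_zero, add_zero] at hm
    linarith
  obtain ⟨i, hi⟩ := exists_closedRotation_eq hP hx a
  have key : ((2 : ℕ) : ℤ) ≤ signVar (closedRotation (truncate P x) i) := by
    rw [hi]
    refine le_signVar_of_alternating_sublist (sublist_map_range_of_pairwise_lt _
      (l := [0, m, P]) ?_ ?_) ?_ ?_ rfl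
    · simp
      omega
    · simp
      omega
    all_goals
      simp only [List.map_cons, List.map_nil, hm, hx a, Nat.cast_zero, add_zero]
    · simp [mul_neg_of_pos_of_neg, mul_neg_of_neg_of_pos, *]
    · simp [ha.ne', hb.ne]
  exact key.trans (signVar_closedRotation_le_cyclicVarMinus _ i)

theorem exists_pos_and_neg_of_signVar_pos {l : List ℝ} (h : 1 ≤ signVar l) :
    (∃ y ∈ l, 0 < y) ∧ ∃ y ∈ l, y < 0 := by
  obtain ⟨q, hq, hc, hl⟩ := exists_alternating_sublist_of_le_signVar (k := 1) h
  obtain ⟨a, b, rfl⟩ := List.length_eq_two.1 hl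
  have ha : a ∈ l := hq.subset (by simp)
  have hb : b ∈ l := hq.subset (by simp)
  rcases mul_neg_iff.1 (List.isChain_cons_cons.1 hc).1 with ⟨h1, h2⟩ | ⟨h1, h2⟩
  · exact ⟨⟨a, ha, h1⟩, b, hb, h2⟩
  · exact ⟨⟨b, hb, h2⟩, a, ha, h1⟩

theorem mem_closedRotation {n : ℕ} {v : Fin n → ℝ} {i : Fin n} {y : ℝ}
    (h : y ∈ closedRotation v i) : ∃ j, v j = y := by
  rcases List.mem_append.1 h with h | h
  · exact List.mem_ofFn.1 (List.mem_of_mem_drop h)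
  · exact List.mem_ofFn.1 (List.mem_of_mem_take h)

theorem exists_nonneg_and_nonpos_of_cyclicVarPlus_pos {n : ℕ} (hn : 0 < n) {v : Fin n → ℝ}
    (h : 1 ≤ cyclicVarPlus v) : (∃ j, 0 ≤ v j) ∧ ∃ j, v j ≤ 0 := by
  have : Nonempty (Fin n) := ⟨⟨0, hn⟩⟩
  have hne : {k : ℤ | ∃ w, IsZeroFilling v w ∧ k = cyclicVarMinus w}.Nonempty :=
    ⟨_, v, fun _ _ => rfl, rfl⟩
  obtain ⟨k, ⟨w, hw, rfl⟩, hk⟩ := exists_lt_of_lt_csSup hne (zero_lt_one.trans_le h)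
  obtain ⟨i, hi⟩ := exists_lt_of_lt_ciSup hk
  obtain ⟨⟨y, hy, hy0⟩, z, hz, hz0⟩ := exists_pos_and_neg_of_signVar_pos (Int.add_one_le_iff.2 hi)
  obtain ⟨j, rfl⟩ := mem_closedRotation hy
  obtain ⟨j', rfl⟩ := mem_closedRotation hz
  refine ⟨⟨j, ?_⟩, j', ?_⟩
  · by_contra! hlt
    linarith [hw j hlt.ne]
  · by_contra! hlt
    linarith [hw j' hlt.ne']

/-! ### Differences -/

theorem cyclicDiff_truncate {P : ℕ} {x : ℤ → ℝ} (hx : Function.Periodic x (P : ℤ)) :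
    cyclicDiff (truncate P x) = truncate P fun t => x (t + 1) - x t := by
  funext i
  obtain ⟨n, rfl⟩ : ∃ n, P = n + 1 := ⟨P - 1, by have := i.2; omega⟩
  simp only [cyclicDiff, truncate, coe_finRotate]
  congr 1
  split_ifs with h
  · rw [← hx, h]
    congr 1
    simp
  · simp

theorem exists_le_diff_nonpos {x : ℤ → ℝ} {a b : ℤ} (hab : a < b) (h : x b ≤ x a) :
    ∃ t, a ≤ t ∧ t < b ∧ x (t + 1) - x t ≤ 0 := by
  by_contra! hcon
  have : ∀ k : ℕ, a + k < b → x a < x (a + k + 1) := fun k => by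
    induction k with
    | zero =>
      intro hk
      have := hcon a le_rfl hab
      simp
      linarith
    | succ k ih =>
      intro hk
      push_cast at hk ⊢
      have h1 := ih (by omega)
      have h2 := hcon (a + k + 1) (by omega) (by omega)
      rw [← add_assoc]
      linarith
  have h1 := this (b - 1 - a).toNat (by omega)
  rw [show a + ((b - 1 - a).toNat : ℤ) + 1 = b by omega] at h1
  linarith

theorem exists_le_diff_nonneg {x : ℤ → ℝ} {a b : ℤ} (hab : a < b) (h : x a ≤ x b) :
    ∃ t, a ≤ t ∧ t < b ∧ 0 ≤ x (t + 1) - x t := by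
  obtain ⟨t, h1, h2, h3⟩ := exists_le_diff_nonpos (x := fun t => -x t) hab (by simpa using h)
  exact ⟨t, h1, h2, by linarith⟩

/-- A discrete, cyclic Rolle theorem. -/
theorem WeaklyAlternates.diff {P : ℕ} {x : ℤ → ℝ} (hx : Function.Periodic x (P : ℤ))
    (h : WeaklyAlternates P x) : WeaklyAlternates P fun t => x (t + 1) - x t := by
  obtain ⟨a, b, c, d, hab, hbc, hcd, hda, ha, hb, hc, hd⟩ := h
  obtain ⟨p, h1, h2, h3⟩ := exists_le_diff_nonpos hab (hb.trans ha)
  obtain ⟨q, h4, h5, h6⟩ := exists_le_diff_nonneg hbc (hb.trans hc)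
  obtain ⟨r, h7, h8, h9⟩ := exists_le_diff_nonpos hcd (hd.trans hc)
  obtain ⟨s, h10, h11, h12⟩ := exists_le_diff_nonneg (x := x) hda (by rw [hx]; exact hd.trans ha)
  -- The differences found have signs `≤, ≥, ≤, ≥`; moving the first by one period gives the
  -- required order.
  refine ⟨q, r, s, p + P, by omega, by omega, by omega, by omega, h6, h9, h12, ?_⟩
  simpa only [add_right_comm p (P : ℤ) 1, hx p, hx (p + 1)] using h3


/-! ### Convolution -/

theorem summable_convolve {g s : ℤ → ℝ} (hg : Summable fun t => |g t|) (hs : ∀ t, |s t| ≤ 1)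
    (t : ℤ) : Summable fun τ => g (t - τ) * s τ := by
  have h : Summable fun τ => |g (t - τ)| := (Equiv.subLeft t).summable_iff.2 hg
  refine Summable.of_norm_bounded h fun τ => ?_
  rw [Real.norm_eq_abs, abs_mul]
  exact mul_le_of_le_one_right (abs_nonneg _) (hs τ)

theorem convolve_eq_tsum (g s : ℤ → ℝ) (t : ℤ) : convolve g s t = ∑' k, g k * s (t - k) := by
  rw [convolve, ← (Equiv.subLeft t).tsum_eq]
  simp

theorem convolve_neg (g s : ℤ → ℝ) (t : ℤ) :
    convolve g (fun τ => -s τ) t = -convolve g s t := by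
  simp [convolve, tsum_neg]

theorem abs_convolve_le {g s : ℤ → ℝ} (hg : Summable fun t => |g t|) (hs : ∀ t, |s t| ≤ 1)
    (t : ℤ) : |convolve g s t| ≤ ∑' k, |g k| := by
  rw [convolve_eq_tsum, ← Real.norm_eq_abs]
  refine tsum_of_norm_bounded hg.hasSum fun k => ?_
  rw [Real.norm_eq_abs, abs_mul]
  exact mul_le_of_le_one_right (abs_nonneg _) (hs _)

theorem periodic_convolve {P : ℤ} {g s : ℤ → ℝ} (hs : Function.Periodic s P) :
    Function.Periodic (convolve g s) P := fun t => by
  simp only [convolve_eq_tsum]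
  congr 1
  funext k
  rw [show t + P - k = t - k + P by ring, hs]

/-- The first difference of a convolution, as a weighted sum of the differences from a fixed
value. -/
theorem convolve_sub_convolve {g s : ℤ → ℝ} (hg : Summable fun t => |g t|) (hs : ∀ t, |s t| ≤ 1)
    (c : ℝ) (t : ℤ) :
    Summable (fun k => (g (k - 1) - g k) * (c - s (t - k))) ∧
      convolve g s t - convolve g s (t - 1) = ∑' k, (g (k - 1) - g k) * (c - s (t - k)) := by
  have hg' : Summable g := hg.of_abs
  have hg1 : Summable fun k => g (k - 1) := (Equiv.subRight (1 : ℤ)).summable_iff.2 hg'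
  -- This equality of sums makes the contribution of `c` cancel.
  have e1 : ∑' k, g (k - 1) = ∑' k, g k := (Equiv.subRight (1 : ℤ)).tsum_eq g
  have h1 : Summable fun k => g k * s (t - k) := by
    have := (Equiv.subLeft t).summable_iff.2 (summable_convolve hg hs t)
    simpa [Function.comp_def] using this
  have h2 : Summable fun k => g (k - 1) * s (t - k) := by
    have := (Equiv.subLeft t).summable_iff.2 (summable_convolve hg hs (t - 1))
    simpa [Function.comp_def, sub_sub_cancel_left, sub_right_comm] using this
  have e2 : convolve g s (t - 1) = ∑' k, g (k - 1) * s (t - k) := by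
    rw [convolve, ← (Equiv.subLeft t).tsum_eq]
    simp [sub_right_comm]
  have hs1 := ((hg1.mul_right c).sub (hg'.mul_right c)).add (h1.sub h2)
  have heq : (fun k => (g (k - 1) - g k) * (c - s (t - k))) =
      fun k => g (k - 1) * c - g k * c + (g k * s (t - k) - g (k - 1) * s (t - k)) := by
    funext k
    ring
  rw [heq]
  refine ⟨hs1, ?_⟩
  rw [((hg1.mul_right c).sub (hg'.mul_right c)).tsum_add (h1.sub h2),
    (hg1.mul_right c).tsum_sub (hg'.mul_right c), h1.tsum_sub h2, tsum_mul_right, tsum_mul_right,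
    e1, e2, convolve_eq_tsum]
  ring

/-- Where a periodic signal is maximal, its convolution with a monotonically decreasing impulse
response increases. -/
theorem convolve_lt_of_isMax {P : ℕ} (hP : 0 < P) {g s : ℤ → ℝ} (hg : Summable fun t => |g t|)
    {t₁ : ℤ} (hsupp : Function.support g = Set.Ici t₁)
    (hanti : StrictAntiOn g (Function.support g)) (hs : ∀ t, |s t| ≤ 1)
    (hper : Function.Periodic s (P : ℤ)) {T T' : ℤ} (hmax : ∀ t, s t ≤ s T) (hT' : s T' < s T) :
    convolve g s (T + t₁ - 1) < convolve g s (T + t₁) := by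
  obtain ⟨hsum, heq⟩ := convolve_sub_convolve hg hs (s T) (T + t₁)
  rw [← sub_pos, heq]
  rw [hsupp] at hanti
  have hlt : ∀ k, t₁ < k → 0 < g (k - 1) - g k := fun k hk =>
    sub_pos.2 (hanti (Set.mem_Ici.2 (by omega)) (Set.mem_Ici.2 hk.le) (by omega))
  have hzero : ∀ k, k < t₁ → g k = 0 := fun k hk => by
    by_contra h0
    have : k ∈ Function.support g := h0
    rw [hsupp, Set.mem_Ici] at this
    omega
  -- At `k = t₁`, where `g` may jump up, the second factor is `s T - s T = 0`.
  have hnn : ∀ k, 0 ≤ (g (k - 1) - g k) * (s T - s (T + t₁ - k)) := fun k => by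
    rcases lt_trichotomy k t₁ with hk | rfl | hk
    · simp [hzero k hk, hzero (k - 1) (by omega)]
    · simp
    · exact mul_nonneg (hlt k hk).le (sub_nonneg.2 (hmax _))
  -- Enough periods to bring a copy of `T'` before `T`; its index then exceeds `t₁`, where the
  -- weight is strictly positive.
  let m : ℤ := |T + t₁ - T'| + |t₁| + 1
  have hm : T' ≤ T - 1 + (m * P) := by
    have h1 : m ≤ m * P := le_mul_of_one_le_right (by positivity) (by exact_mod_cast hP)
    have h2 := neg_abs_le (T + t₁ - T')
    have h3 := le_abs_self t₁
    omega
  have hs' : s (T' - m * P) = s T' := by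
    have := hper.int_mul m (T' - m * P)
    rw [← this]
    simp
  refine hsum.tsum_pos hnn (T + t₁ - (T' - m * P)) (mul_pos (hlt _ (by omega)) ?_)
  rw [sub_sub_cancel, hs']
  exact sub_pos.2 hT'

/-! ### Periodic summation -/

theorem periodic_periodicSum (P : ℕ) (g : ℤ → ℝ) :
    Function.Periodic (periodicSum P g) (P : ℤ) := fun t => by
  unfold periodicSum
  rw [← (Equiv.addRight (1 : ℤ)).tsum_eq fun i : ℤ => g (t + i * P)]
  congr 1
  funext i
  simp only [Equiv.coe_addRight]
  congr 1
  ring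

/-- Convolution with a periodic signal is cyclic convolution with the periodic summation. -/
theorem convolve_eq_sum_periodicSum {P : ℕ} (hP : 0 < P) {g s : ℤ → ℝ}
    (hg : Summable fun t => |g t|) (hs : ∀ t, |s t| ≤ 1) (hper : Function.Periodic s (P : ℤ))
    (t : ℤ) :
    convolve g s t = ∑ j : Fin P, periodicSum P g (t - (j : ℕ)) * s (j : ℕ) := by
  have : NeZero P := ⟨hP.ne'⟩
  have h := summable_convolve hg hs t
  have h' := (Int.divModEquiv P).symm.summable_iff.2 h
  have hswap := (Equiv.prodComm (Fin P) ℤ).summable_iff.2 h'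
  rw [convolve, ← (Int.divModEquiv P).symm.tsum_eq, ← (Equiv.prodComm (Fin P) ℤ).tsum_eq]
  refine (hswap.tsum_prod).trans ?_
  rw [tsum_fintype]
  refine Finset.sum_congr rfl fun j _ => ?_
  -- With `τ = iP + j`, the substitution of `-i` for `i` matches the sign convention of the periodic
  -- summation.
  rw [periodicSum, ← tsum_mul_right, ← (Equiv.neg ℤ).tsum_eq]
  congr 1
  funext i
  have hgi : t - (-i * P + (j : ℕ)) = t - (j : ℕ) + i * P := by ring
  have hsi : s (-i * P + (j : ℕ)) = s (j : ℕ) := by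
    rw [add_comm]
    exact hper.int_mul (-i) (j : ℕ)
  change g (t - (-i * P + (j : ℕ))) * s (-i * P + (j : ℕ)) = _
  rw [hgi, hsi]

theorem truncate_sub {P : ℕ} {x : ℤ → ℝ} (hx : Function.Periodic x (P : ℤ)) (i j : Fin P) :
    truncate P x (i - j) = x ((i : ℕ) - (j : ℕ)) := by
  unfold truncate
  rw [Fin.sub_def]
  simp only
  have hj := j.2
  have h := Int.emod_add_mul_ediv ((P - (j : ℕ) + (i : ℕ) : ℕ) : ℤ) P
  rw [Int.natCast_mod, ← hx.int_mul (((P - (j : ℕ) + (i : ℕ) : ℕ) : ℤ) / P),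
    ← hx ((i : ℕ) - (j : ℕ))]
  congr 1
  simp only [Int.cast_id]
  rw [mul_comm, h]
  omega

/-- All columns of a circulant matrix have the same sum. With `sum_sign`, this makes `o` sum to zero
in the balanced case. -/
theorem sum_circulant_mulVec {n : ℕ} (v s : Fin n → ℝ) :
    ∑ i, (Matrix.circulant v).mulVec s i = (∑ i, v i) * ∑ j, s j := by
  rcases n with _ | n
  · simp
  simp only [Matrix.mulVec, dotProduct, Matrix.circulant_apply]
  rw [Finset.sum_comm, Finset.mul_sum]
  refine Finset.sum_congr rfl fun j _ => ?_
  rw [← Finset.sum_mul]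
  congr 1
  exact (Equiv.subRight j).sum_comp v

theorem sum_sign {n : ℕ} (v : Fin n → ℝ) :
    ∑ i, Real.sign (v i) = (numPos v : ℝ) - numNeg v := by
  simp only [numPos, numNeg, Finset.card_filter, Nat.cast_sum, ← Finset.sum_sub_distrib]
  refine Finset.sum_congr rfl fun i _ => ?_
  rcases lt_trichotomy (v i) 0 with h | h | h
  · simp [Real.sign_of_neg h, h, h.not_gt]
  · simp [h]
  · simp [Real.sign_of_pos h, h, h.not_gt]

theorem abs_sign_le_one (r : ℝ) : |Real.sign r| ≤ 1 := by
  rcases Real.sign_apply_eq r with h | h | h <;> simp [h]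

theorem sign_nonpos {r : ℝ} (h : r ≤ 0) : Real.sign r ≤ 0 := by
  rcases h.lt_or_eq with h | rfl
  · simp [Real.sign_of_neg h]
  · simp

theorem sign_nonneg {r : ℝ} (h : 0 ≤ r) : 0 ≤ Real.sign r := by
  rcases h.lt_or_eq with h | rfl
  · simp [Real.sign_of_pos h]
  · simp

end RelayFeedback

/-! ### Unimodality of the loop gain -/

open RelayFeedback in
theorem mainTheorem6 (P : ℕ) (hP : 1 < P) (g u : ℤ → ℝ)
    (hg : StrictlyDecreasingImpulse g) (hu : UnimodalityAssumption P u)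
    (o : Fin P → ℝ)
    (ho : o = (-Matrix.circulant (truncate P (periodicSum P g))).mulVec
      (fun i => Real.sign (truncate P u i))) :
    truncate P (loopGain g u) = o ∧
    cyclicVarMinus (cyclicDiff o) ≤ 2 ∧
    cyclicVarMinus o ≤ 2 ∧
    (numPos (truncate P u) = numNeg (truncate P u) →
      cyclicVarPlus o ≤ 2 ∧ UnimodalityAssumption P (loopGain g u)) := by
  have hP0 : 0 < P := by omega
  have huper : Function.Periodic u (P : ℤ) := hu.boundedPeriodic.periodic
  set s : ℤ → ℝ := fun t => Real.sign (u t) with hs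
  have hs1 : ∀ t, |s t| ≤ 1 := fun t => abs_sign_le_one _
  have hsper : Function.Periodic s (P : ℤ) := fun t => by simp only [hs, huper t]
  have hoper : Function.Periodic (loopGain g u) (P : ℤ) := fun t => by
    simp only [loopGain]
    rw [periodic_convolve hsper]
  have htr : truncate P (loopGain g u) = o := by
    rw [ho]
    funext i
    rw [Matrix.neg_mulVec, Pi.neg_apply, truncate, loopGain,
      convolve_eq_sum_periodicSum hP0 hg.summable hs1 hsper]
    simp only [Matrix.mulVec, dotProduct, Matrix.circulant_apply,
      truncate_sub (periodic_periodicSum P g)]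
    rfl
  set d : ℤ → ℝ := fun t => loopGain g u (t + 1) - loopGain g u t with hd
  have hdper : Function.Periodic d (P : ℤ) := fun t => by
    simp only [hd]
    rw [add_right_comm, hoper, hoper]
  obtain ⟨⟨j₁, hj₁⟩, j₂, hj₂⟩ := exists_nonneg_and_nonpos_of_cyclicVarPlus_pos hP0
    (v := truncate P u) (by rw [hu.varPlus]; norm_num)
  simp only [truncate] at hj₁ hj₂
  -- Only the condition on `Δ_c u` excludes `u = 0`: for `P = 2` the zero vector has the filling
  -- `(1, -1)` and hence `S_c^+ = 2`.
  obtain ⟨j₀, hj₀⟩ : ∃ t, u t ≠ 0 := by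
    by_contra! h0
    have h1 : cyclicVarMinus (cyclicDiff (truncate P u)) ≤ 0 := by
      have : Nonempty (Fin P) := ⟨j₁⟩
      refine ciSup_le fun i => ?_
      by_contra! hlt
      obtain ⟨⟨y, hy, hy0⟩, -⟩ := exists_pos_and_neg_of_signVar_pos (Int.add_one_le_iff.2 hlt)
      obtain ⟨j, rfl⟩ := mem_closedRotation hy
      simp [cyclicDiff, truncate, h0] at hy0
    rw [hu.varMinus_diff] at h1
    norm_num at h1
  obtain ⟨t₁, hsupp⟩ := hg.support_eq
  have hmaxd : ∀ T T', (∀ t, s t ≤ s T) → s T' < s T → d (T + t₁ - 1) < 0 := by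
    intro T T' hmax hT'
    have := convolve_lt_of_isMax hP0 hg.summable hsupp hg.strictAntiOn hs1 hsper hmax hT'
    simp only [hd, loopGain, sub_add_cancel]
    linarith
  have hmind : ∀ T T', (∀ t, s T ≤ s t) → s T < s T' → 0 < d (T + t₁ - 1) := by
    intro T T' hmin hT'
    have := convolve_lt_of_isMax hP0 (s := fun t => -s t) hg.summable hsupp hg.strictAntiOn
      (fun t => by simpa using hs1 t) (fun t => by simp only [hsper t])
      (fun t => neg_le_neg (hmin t)) (neg_lt_neg hT')
    rw [convolve_neg, convolve_neg] at this
    simp only [hd, loopGain, sub_add_cancel]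
    linarith
  have hposd : ∀ T, 0 < u T → d (T + t₁ - 1) < 0 := fun T hT => by
    have h1 : s T = 1 := Real.sign_of_pos hT
    refine hmaxd T j₂ (fun t => h1 ▸ (abs_le.1 (hs1 t)).2) ?_
    rw [h1]
    exact (sign_nonpos hj₂).trans_lt one_pos
  have hnegd : ∀ T, u T < 0 → 0 < d (T + t₁ - 1) := fun T hT => by
    have h1 : s T = -1 := Real.sign_of_neg hT
    refine hmind T j₁ (fun t => h1 ▸ (abs_le.1 (hs1 t)).1) ?_
    rw [h1]
    exact lt_of_lt_of_le (by norm_num) (sign_nonneg hj₁)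
  have hd_neg : ∃ t, d t < 0 := by
    by_cases h : ∃ T, 0 < u T
    · obtain ⟨T, hT⟩ := h
      exact ⟨_, hposd T hT⟩
    -- Without positive values of `u`, the maximum of `s` is `0`, attained at `j₁`.
    · push Not at h
      have h0 : s j₁ = 0 := by simp [hs, le_antisymm (h j₁) hj₁]
      refine ⟨_, hmaxd j₁ j₀ (fun t => h0 ▸ sign_nonpos (h t)) ?_⟩
      rw [h0]
      simp [hs, Real.sign_of_neg (lt_of_le_of_ne (h j₀) hj₀)]
  have hd_pos : ∃ t, 0 < d t := by
    by_cases h : ∃ T, u T < 0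
    · obtain ⟨T, hT⟩ := h
      exact ⟨_, hnegd T hT⟩
    · push Not at h
      have h0 : s j₂ = 0 := by simp [hs, le_antisymm hj₂ (h j₂)]
      refine ⟨_, hmind j₂ j₀ (fun t => h0 ▸ sign_nonneg (h t)) ?_⟩
      rw [h0]
      simp [hs, Real.sign_of_pos (lt_of_le_of_ne (h j₀) (Ne.symm hj₀))]
  have hdwa : ¬ WeaklyAlternates P d := by
    rintro ⟨a, b, c, e, hab, hbc, hce, hea, ha, hb, hc, he⟩
    have hnp : ∀ t, 0 ≤ d t → u (t + 1 - t₁) ≤ 0 := fun t ht => by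
      by_contra! hlt
      have := hposd _ hlt
      rw [sub_add_cancel, add_sub_cancel_right] at this
      linarith
    have hnn : ∀ t, d t ≤ 0 → 0 ≤ u (t + 1 - t₁) := fun t ht => by
      by_contra! hlt
      have := hnegd _ hlt
      rw [sub_add_cancel, add_sub_cancel_right] at this
      linarith
    -- The signs of `u` are reversed, so the alternation starts at `b` and `a` moves to the end by
    -- one period.
    refine not_weaklyAlternates_of_cyclicVarPlus_le_two hP0 huper hu.varPlus.le
      ⟨b + 1 - t₁, c + 1 - t₁, e + 1 - t₁, a + P + 1 - t₁, by omega, by omega, by omega, by omega,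
        hnn b hb, hnp c hc, hnn e he, hnp _ ?_⟩
    rwa [hdper]
  have hvd : cyclicVarMinus (cyclicDiff o) ≤ 2 := by
    rw [← htr, cyclicDiff_truncate hoper]
    exact (cyclicVarMinus_le_cyclicVarPlus _).trans (cyclicVarPlus_le_two hP0 hdper hdwa)
  -- This bound does not depend on the balance of signs.
  have hvo : cyclicVarPlus o ≤ 2 := by
    rw [← htr]
    exact cyclicVarPlus_le_two hP0 hoper fun h => hdwa (h.diff hoper)
  refine ⟨htr, hvd, (cyclicVarMinus_le_cyclicVarPlus _).trans hvo, fun hbal => ⟨hvo, ?_⟩⟩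
  have hsum : ∑ i, truncate P (loopGain g u) i = 0 := by
    rw [htr, ho]
    simp only [Matrix.neg_mulVec, Pi.neg_apply, Finset.sum_neg_distrib]
    rw [sum_circulant_mulVec, sum_sign, hbal, sub_self, mul_zero, neg_zero]
  -- `o` is not zero because `d` is not; having sum zero, it then takes both signs.
  obtain ⟨i₀, hi₀⟩ : ∃ i, truncate P (loopGain g u) i ≠ 0 := by
    by_contra! h0
    obtain ⟨t, ht⟩ := hd_pos
    have hz : loopGain g u = 0 := by
      rw [← periodicExtension_truncate hP0 hoper]
      funext t
      exact h0 _
    simp [hd, hz] at ht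
  obtain ⟨a, -, ha⟩ := Finset.exists_pos_of_sum_zero_of_exists_nonzero _ hsum
    ⟨i₀, Finset.mem_univ _, hi₀⟩
  obtain ⟨b, -, hb⟩ := Finset.exists_pos_of_sum_zero_of_exists_nonzero
    (fun i => -truncate P (loopGain g u) i) (s := Finset.univ) (by simp [hsum])
    ⟨i₀, Finset.mem_univ _, neg_ne_zero.2 hi₀⟩
  obtain ⟨p, hp⟩ := hd_pos
  obtain ⟨q, hq⟩ := hd_neg
  refine ⟨⟨⟨∑' k, |g k|, ?_⟩, hoper⟩, le_antisymm (htr ▸ hvd) ?_, le_antisymm (htr ▸ hvo) ?_⟩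
  · rintro _ ⟨t, rfl⟩
    simpa only [loopGain, abs_neg] using abs_convolve_le hg.summable hs1 t
  · rw [cyclicDiff_truncate hoper]
    exact two_le_cyclicVarMinus hP0 hdper hp hq
  · exact (two_le_cyclicVarMinus hP0 hoper ha (neg_pos.1 hb)).trans
      (cyclicVarMinus_le_cyclicVarPlus _)
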